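/- For integers $l\ge 0$ let $P_l(x)=\frac{1}{2^l\,l!}\frac{d^l}{dx^l}(x^2-1)^l$ be the Legendre polynomial, and for integers $0\le m\le l$ let $$P_l^m(x)=(-1)^m(1-x^2)^{m/2}\frac{d^m}{dx^m}P_l(x),\qquad x\in[-1,1],$$ be the associated Legendre function, so that $P_l^0=P_l$ and $P_2(x)=\frac12(3x^2-1)$. For even $m$, $P_l^m$ is a polynomial, and $P_2\mid P_l^m$ means divisibility in $\mathbb{R}[x]$. For odd $m$, $P_l^m/\sqrt{1-x^2}$ is a polynomial, and $P_2\mid P_l^m$ means that $P_2$ divides this polynomial in $\mathbb{R}[x]$. **Theorem.** 1. ($m=0$) For every integer $l\ge 0$: $P_2\mid P_l$ if and only if $l=2$. 2. ($m=2$) For every integer $l\ge 2$: $P_2\mid P_l^2$ if and only if $l=5$. 3. If $m\ge 0$ is even, then there exists at most one integer $l\ge m$ such that $P_2\mid P_l^m$. 4. If $m\ge 1$ is odd, then $P_2\nmid P_l^m$ for all integers $l\ge m$. -/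

import Mathlib

open Polynomial

noncomputable section

/-- The Legendre polynomial `P_l`, by Rodrigues' formula
`P_l = (1 / (2 ^ l * l!)) * d^l/dx^l (x ^ 2 - 1) ^ l`. -/
def legendrePolynomial (l : ℕ) : ℝ[X] :=
  C (1 / (2 ^ l * (l.factorial : ℝ))) * derivative^[l] ((X ^ 2 - 1) ^ l)

/-- The associated Legendre function
`P_l^m(x) = (-1) ^ m * (1 - x ^ 2) ^ (m / 2) * d^m/dx^m P_l(x)` for `0 ≤ m ≤ l`, meant for `x`
in `[-1, 1]`. -/
def associatedLegendre (l m : ℕ) (x : ℝ) : ℝ :=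
  (-1) ^ m * Real.sqrt (1 - x ^ 2) ^ m * (derivative^[m] (legendrePolynomial l)).eval x

/-- `p ∣ P_l^m` for a real polynomial `p`: for even `m` the function `P_l^m` is a polynomial,
for odd `m` the function `P_l^m / √(1 - x ^ 2)` is a polynomial, and this polynomial has to be
divisible by `p` in `ℝ[X]`. The equality of functions is on the interval `(-1, 1)`, which
determines the polynomial `R`. -/
def DvdAssociatedLegendre (p : ℝ[X]) (l m : ℕ) : Prop :=
  ∃ R : ℝ[X],
    (∀ x ∈ Set.Ioo (-1 : ℝ) 1,
      associatedLegendre l m x / (if Even m then 1 else Real.sqrt (1 - x ^ 2)) = R.eval x) ∧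
    p ∣ R

end

/-! Divisibility by `P_2` forces the `(l + m)`-th derivative of `(x ^ 2 - 1) ^ l` to vanish at `x =
1/√3`. Rescaling the Taylor expansion there by `x` turns this into the vanishing of the coefficient
of `X ^ (l + m)` in `(X ^ 2 + 2 * X - 2) ^ l`. For `l = m + 2 * p + e`, `e ≤ 1`, that coefficient is
a nonzero multiple of `legendreSum e m p`, a sum of 2-adic integers. Suppose it vanishes. Modulo 2
only `1 + p * (p + m)` survives, so `p = 2 * r + 1` and `m = 2 * k`. Pairing consecutive terms gains
powers of 2; modulo 4 the parity of `k` fixes `e`. If `r ≠ r'` both gave zero, the difference of the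
sums divided by `4 * (r - r')` would be odd (`eq_of_legendreSum_eq_zero`). Hence each `m` admits at
most one `l`, and `l = 2`, `l = 5` are checked directly. -/

/-! ### Inverses of odd numbers in `ℤ_[2]` -/

/-- The inverse in `ℤ_[2]` of the odd number `2 * k + 1`. -/
noncomputable def oddInv (k : ℕ) : ℤ_[2] := Ring.inverse (2 * k + 1)

lemma toZMod_two_mul_add_one (x : ℤ_[2]) : PadicInt.toZMod (2 * x + 1) = 1 := by
  have : (2 : ZMod 2) = 0 := rfl
  simp [map_ofNat, this]

lemma mul_oddInv (k : ℕ) : (2 * k + 1 : ℤ_[2]) * oddInv k = 1 := by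
  refine Ring.mul_inverse_cancel _ ?_
  by_contra h
  rw [← mem_nonunits_iff, ← IsLocalRing.mem_maximalIdeal, ← PadicInt.ker_toZMod,
    RingHom.mem_ker, toZMod_two_mul_add_one] at h
  exact one_ne_zero h

lemma toZMod_oddInv (k : ℕ) : PadicInt.toZMod (oddInv k) = 1 := by
  have := congrArg PadicInt.toZMod (mul_oddInv k)
  rwa [map_mul, toZMod_two_mul_add_one, one_mul, map_one] at this

/-- The inverse of `∏ s < j, (2 * s + 1 + 2 * e)`. -/
noncomputable def oddProdInv (e j : ℕ) : ℤ_[2] := ∏ s ∈ Finset.range j, oddInv (s + e)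

lemma toZMod_oddProdInv (e j : ℕ) : PadicInt.toZMod (oddProdInv e j) = 1 := by
  simp [oddProdInv, toZMod_oddInv]

lemma factorial_mul_oddProdInv {e : ℕ} (he : e ≤ 1) (j : ℕ) :
    ((2 * j + e).factorial : ℤ_[2]) * oddProdInv e j = 2 ^ j * (j.factorial : ℤ_[2]) := by
  induction j with
  | zero => interval_cases e <;> simp [oddProdInv]
  | succ j ih =>
    have h := mul_oddInv (j + e)
    rw [oddProdInv, Finset.prod_range_succ, ← oddProdInv]
    have : ((2 * (j + 1) + e).factorial : ℤ_[2]) =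
        2 * (j + 1) * (2 * (j + e : ℕ) + 1) * ((2 * j + e).factorial : ℤ_[2]) := by
      rw [show 2 * (j + 1) + e = (2 * j + e + 1) + 1 by ring, Nat.factorial_succ,
        Nat.factorial_succ]
      interval_cases e <;> push_cast <;> ring
    rw [this, Nat.factorial_succ, pow_succ]
    push_cast at h ⊢
    linear_combination 2 * (j + 1 : ℤ_[2]) * (2 * (j + e) + 1) * oddInv (j + e) * ih +
      2 ^ j * (j.factorial : ℤ_[2]) * 2 * (j + 1) * h

lemma cast_choose_succ_mul (R : Type*) [CommRing R] (n k : ℕ) :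
    (n.choose (k + 1) : R) * (k + 1) = n.choose k * (n - k) := by
  rcases le_or_gt k n with h | h
  · have := congrArg (Nat.cast (R := R)) (Nat.choose_succ_right_eq n k)
    push_cast [Nat.cast_sub h] at this
    exact this
  · simp [Nat.choose_eq_zero_of_lt h, Nat.choose_eq_zero_of_lt (h.trans k.lt_succ_self)]

lemma cast_descFactorial_succ (R : Type*) [CommRing R] (n k : ℕ) :
    (n.descFactorial (k + 1) : R) = n.descFactorial k * (n - k) := by
  rcases le_or_gt k n with h | h
  · rw [Nat.descFactorial_succ]
    push_cast [Nat.cast_sub h]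
    ring
  · simp [Nat.descFactorial_of_lt h]

/-! ### Products of binomials and their 2-adic variation -/

/-- The number `j! * (p choose j) * (q choose j)`. -/
def choosePair (p q j : ℕ) : ℕ := p.choose j * q.descFactorial j

lemma choosePair_zero (p q : ℕ) : choosePair p q 0 = 1 := by simp [choosePair]

lemma choosePair_one (p q : ℕ) : choosePair p q 1 = p * q := by simp [choosePair]

lemma choosePair_succ_mul (p q j : ℕ) :
    (choosePair p q (j + 1) : ℤ_[2]) * (j + 1) = choosePair p q j * ((p - j) * (q - j)) := by
  have h := cast_choose_succ_mul ℤ_[2] p j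
  simp only [choosePair, Nat.cast_mul, cast_descFactorial_succ]
  linear_combination (q.descFactorial j : ℤ_[2]) * (q - j) * h

lemma even_choosePair (p q : ℕ) {j : ℕ} (hj : 2 ≤ j) : Even (choosePair p q j) := by
  rw [choosePair, Nat.descFactorial_eq_factorial_mul_choose]
  exact ((even_iff_two_dvd.2 (Nat.dvd_factorial two_pos hj)).mul_right _).mul_left _

/-- The falling factorial is a polynomial in its base with integer coefficients. -/
lemma sub_dvd_descFactorial_sub (a b j : ℕ) :
    (a - b : ℤ_[2]) ∣ a.descFactorial j - b.descFactorial j := by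
  have := sub_dvd_eval_sub (a : ℤ_[2]) b (descPochhammer ℤ_[2] j)
  rwa [descPochhammer_eval_eq_descFactorial, descPochhammer_eval_eq_descFactorial] at this

/-- The factor `j!` can be attached to either binomial. Changing one argument at a time, it is
attached to the one that moves, so no denominator appears. -/
lemma sub_dvd_choosePair_sub (r r' k j : ℕ) :
    (r - r' : ℤ_[2]) ∣ choosePair r (r + k) j - choosePair r' (r' + k) j := by
  have h1 := sub_dvd_descFactorial_sub r r' j
  have h2 := sub_dvd_descFactorial_sub (r + k) (r' + k) j
  have e : (choosePair r' (r' + k) j : ℤ_[2]) = r'.descFactorial j * (r' + k).choose j := by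
    simp only [choosePair, Nat.descFactorial_eq_factorial_mul_choose]
    push_cast; ring
  have e' : (choosePair r (r + k) j : ℤ_[2]) = r.choose j * (r + k).descFactorial j := by
    simp [choosePair]
  have e'' : (r'.choose j * (r' + k).descFactorial j : ℤ_[2]) =
      r'.descFactorial j * (r' + k).choose j := by
    simp only [Nat.descFactorial_eq_factorial_mul_choose]
    push_cast; ring
  have e3 : (r.choose j * (r' + k).descFactorial j : ℤ_[2]) =
      r.descFactorial j * (r' + k).choose j := by
    simp only [Nat.descFactorial_eq_factorial_mul_choose]
    push_cast; ring
  rw [Nat.cast_add, Nat.cast_add, add_sub_add_right_eq_sub] at h2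
  have : (choosePair r (r + k) j - choosePair r' (r' + k) j : ℤ_[2]) =
      r.choose j * ((r + k).descFactorial j - (r' + k).descFactorial j) +
      (r.descFactorial j - r'.descFactorial j) * (r' + k).choose j := by
    rw [e, e']
    linear_combination e3
  rw [this]
  exact dvd_add (h2.mul_left _) (h1.mul_right _)

/-! ### The hypergeometric sum modulo 2 -/

/-- The terminating hypergeometric sum `∑ j, (-1) ^ j * j! * (p choose j) * (p + m choose j) / O j`
with `O j = ∏ s < j, (2 * s + 1 + 2 * e)`. -/
noncomputable def legendreSum (e m p : ℕ) : ℤ_[2] :=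
  ∑ j ∈ Finset.range (p + 1), (-1) ^ j * (choosePair p (p + m) j : ℤ_[2]) * oddProdInv e j

lemma legendreSum_eq_sum_range (e m p : ℕ) {N : ℕ} (hN : p + 1 ≤ N) :
    legendreSum e m p =
      ∑ j ∈ Finset.range N, (-1) ^ j * (choosePair p (p + m) j : ℤ_[2]) * oddProdInv e j := by
  refine Finset.sum_subset (Finset.range_mono hN) fun j _ hj => ?_
  have : p < j := by simpa using hj
  simp [choosePair, Nat.choose_eq_zero_of_lt this]

/-- The factor `j!` kills every term with `j ≥ 2` modulo 2. -/
lemma odd_mul_of_legendreSum_eq_zero {e m p : ℕ} (h : legendreSum e m p = 0) :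
    Odd (p * (p + m)) := by
  rw [legendreSum_eq_sum_range e m p (N := p + 2) (by omega), Finset.sum_range_succ',
    Finset.sum_range_succ'] at h
  have h := congrArg PadicInt.toZMod h
  simp only [map_add, map_sum, map_mul, toZMod_oddProdInv, map_natCast, map_zero, map_pow,
    map_neg, map_one, mul_one] at h
  rw [Finset.sum_eq_zero, zero_add, zero_add, choosePair_one, choosePair_zero] at h
  · rw [← ZMod.natCast_eq_one_iff_odd]
    linear_combination -h
  · intro j _
    rw [(ZMod.natCast_eq_zero_iff_even).2 (even_choosePair p (p + m) (by omega)), mul_zero]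

/-! ### Pairing consecutive terms -/

/-- The odd part of `choosePair (2 * r + 1) (2 * r + 1 + 2 * k) (2 * i)`. -/
noncomputable def oddPart (k r i : ℕ) : ℤ_[2] :=
  ∏ s ∈ Finset.range i, (2 * (r - s) + 1) * (2 * (r + k - s) + 1) * oddInv s

lemma choosePair_two_mul (k r i : ℕ) :
    (choosePair (2 * r + 1) (2 * r + 1 + 2 * k) (2 * i) : ℤ_[2]) =
      2 ^ i * choosePair r (r + k) i * oddPart k r i := by
  induction i with
  | zero => simp [choosePair_zero, oddPart]
  | succ i ih =>
    have h1 := choosePair_succ_mul (2 * r + 1) (2 * r + 1 + 2 * k) (2 * i)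
    have h2 := choosePair_succ_mul (2 * r + 1) (2 * r + 1 + 2 * k) (2 * i + 1)
    have h3 := choosePair_succ_mul r (r + k) i
    have h4 := mul_oddInv i
    -- The recurrence is applied twice, so its denominators `2 * i + 2` and `2 * i + 1` are cleared
    -- first.
    have hi : ((2 * i + 1 + 1 : ℕ) : ℤ_[2]) ≠ 0 := Nat.cast_ne_zero.2 (by omega)
    have hi' : ((2 * i + 1 : ℕ) : ℤ_[2]) ≠ 0 := Nat.cast_ne_zero.2 (by omega)
    refine mul_right_cancel₀ hi (mul_right_cancel₀ hi' ?_)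
    rw [oddPart, Finset.prod_range_succ, ← oddPart, show 2 * (i + 1) = 2 * i + 1 + 1 by ring,
      pow_succ]
    push_cast at h1 h2 h3 h4 ih ⊢
    linear_combination (2 * i + 1 : ℤ_[2]) * h2 +
      4 * (r - i : ℤ_[2]) * (r + k - i) * h1 +
      4 * (r - i : ℤ_[2]) * (r + k - i) * (2 * (r - i) + 1) * (2 * (r + k - i) + 1) * ih -
      4 * 2 ^ i * oddPart k r i * (2 * (r - i) + 1) * (2 * (r + k - i) + 1) * oddInv i *
        (2 * i + 1) * h3 -
      4 * 2 ^ i * oddPart k r i * choosePair r (r + k) i * (r - i) * (r + k - i) *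
        (2 * (r - i) + 1) * (2 * (r + k - i) + 1) * h4

/-- Half of `(2 * i + 1) * (4 * i + 1 + 2 * e) - (p - 2 * i) * (p + 2 * k - 2 * i)` for
`p = 2 * r + 1`. -/
noncomputable def pairDefect (e k r i : ℕ) : ℤ_[2] :=
  4 * i ^ 2 + 3 * i + e * (2 * i + 1) - k - 2 * ((r - i) * (r - i + 1 + k))

/-- The cofactor of `2 ^ (i + 1) * choosePair r (r + k) i` in the sum of the terms with index
`2 * i` and `2 * i + 1` of `legendreSum e (2 * k) (2 * r + 1)`. -/
noncomputable def pairCofactor (e k r i : ℕ) : ℤ_[2] :=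
  oddPart k r i * pairDefect e k r i *
    (oddProdInv e (2 * i) * oddInv i * oddInv (2 * i + e))

lemma pair_sum_eq (e k r i : ℕ) :
    (-1) ^ (2 * i) * (choosePair (2 * r + 1) (2 * r + 1 + 2 * k) (2 * i) : ℤ_[2]) *
        oddProdInv e (2 * i) +
      (-1) ^ (2 * i + 1) * (choosePair (2 * r + 1) (2 * r + 1 + 2 * k) (2 * i + 1) : ℤ_[2]) *
        oddProdInv e (2 * i + 1) =
      2 ^ (i + 1) * choosePair r (r + k) i * pairCofactor e k r i := by
  have h1 := choosePair_succ_mul (2 * r + 1) (2 * r + 1 + 2 * k) (2 * i)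
  have h2 := choosePair_two_mul k r i
  have h3 := mul_oddInv i
  have h4 := mul_oddInv (2 * i + e)
  have h5 : oddProdInv e (2 * i + 1) = oddProdInv e (2 * i) * oddInv (2 * i + e) := by
    rw [oddProdInv, Finset.prod_range_succ, ← oddProdInv]
  have h6 : (choosePair (2 * r + 1) (2 * r + 1 + 2 * k) (2 * i + 1) : ℤ_[2]) =
      choosePair (2 * r + 1) (2 * r + 1 + 2 * k) (2 * i) *
        ((2 * (r - i) + 1) * (2 * (r + k - i) + 1)) * oddInv i := by
    push_cast at h1
    linear_combination oddInv i * h1 -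
      (choosePair (2 * r + 1) (2 * r + 1 + 2 * k) (2 * i + 1) : ℤ_[2]) * h3
  rw [pow_succ, pow_mul, neg_one_sq, one_pow, h6, h5, h2, pairCofactor, pairDefect, pow_succ]
  push_cast at h4
  have h7 : (2 * i + 1 : ℤ_[2]) * (2 * (2 * i + e) + 1) * (oddInv i * oddInv (2 * i + e)) = 1 := by
    linear_combination (2 * (2 * i + e) + 1 : ℤ_[2]) * oddInv (2 * i + e) * h3 + h4
  linear_combination (-(2 ^ i * (choosePair r (r + k) i : ℤ_[2]) * oddPart k r i *
    oddProdInv e (2 * i))) * h7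

lemma legendreSum_eq_sum_pairs (e k r : ℕ) {N : ℕ} (hN : r + 1 ≤ N) :
    legendreSum e (2 * k) (2 * r + 1) =
      ∑ i ∈ Finset.range N, 2 ^ (i + 1) * choosePair r (r + k) i * pairCofactor e k r i := by
  rw [legendreSum_eq_sum_range e (2 * k) (2 * r + 1) (N := 2 * N) (by omega)]
  clear hN
  induction N with
  | zero => simp
  | succ N ih =>
    rw [show 2 * (N + 1) = 2 * N + 1 + 1 by ring, Finset.sum_range_succ, Finset.sum_range_succ,
      Finset.sum_range_succ, ih, add_assoc, pair_sum_eq]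

lemma two_mul_sub_dvd_pairCofactor_sub (e k r r' i : ℕ) :
    (2 * (r - r') : ℤ_[2]) ∣ pairCofactor e k r i - pairCofactor e k r' i := by
  have h1 : (2 * (r - r') : ℤ_[2]) ∣ oddPart k r i - oddPart k r' i := by
    induction i with
    | zero => simp [oddPart]
    | succ i ih =>
      simp only [oddPart, Finset.prod_range_succ]
      refine dvd_mul_sub_mul ih (dvd_mul_sub_mul (dvd_mul_sub_mul ⟨1, ?_⟩ ⟨1, ?_⟩) (by simp)) <;>
        ring
  have h2 : (2 * (r - r') : ℤ_[2]) ∣ pairDefect e k r i - pairDefect e k r' i :=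
    ⟨-(r + r' - 2 * i + 1 + k), by simp only [pairDefect]; ring⟩
  exact dvd_mul_sub_mul (dvd_mul_sub_mul h1 h2) (by simp)

lemma toZMod_pairCofactor (e k r i : ℕ) :
    PadicInt.toZMod (pairCofactor e k r i) = i + e + k := by
  have h2 : (2 : ZMod 2) = 0 := rfl
  have h3 : (3 : ZMod 2) = 1 := rfl
  have h4 : (4 : ZMod 2) = 0 := rfl
  have ho : PadicInt.toZMod (oddPart k r i) = 1 := by
    simp [oddPart, toZMod_oddInv, map_ofNat, h2]
  simp [pairCofactor, pairDefect, ho, toZMod_oddInv, toZMod_oddProdInv, map_ofNat, h2, h3, h4,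
    CharTwo.sub_eq_add]

/-! ### Zeros of the sum modulo 4 and uniqueness of `r` -/

lemma natCast_eq_of_legendreSum_eq_zero {e k r : ℕ}
    (h : legendreSum e (2 * k) (2 * r + 1) = 0) : (e : ZMod 2) = k := by
  rw [legendreSum_eq_sum_pairs e k r le_rfl, Finset.sum_range_succ'] at h
  obtain ⟨c, hc⟩ : (4 : ℤ_[2]) ∣ ∑ i ∈ Finset.range r, 2 ^ (i + 1 + 1) *
      choosePair r (r + k) (i + 1) * pairCofactor e k r (i + 1) :=
    Finset.dvd_sum fun i _ => ⟨2 ^ i * choosePair r (r + k) (i + 1) *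
      pairCofactor e k r (i + 1), by ring⟩
  rw [hc, choosePair_zero] at h
  have h' : pairCofactor e k r 0 = 2 * -c := by
    refine mul_left_cancel₀ (two_ne_zero (α := ℤ_[2])) ?_
    push_cast at h
    linear_combination h
  have h2 : (2 : ZMod 2) = 0 := rfl
  have := congrArg PadicInt.toZMod h'
  simp only [toZMod_pairCofactor, map_mul, map_ofNat, h2, zero_mul, Nat.cast_zero,
    zero_add] at this
  linear_combination this - (k : ZMod 2) * h2

lemma eq_of_legendreSum_eq_zero {e k r r' : ℕ} (h : legendreSum e (2 * k) (2 * r + 1) = 0)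
    (h' : legendreSum e (2 * k) (2 * r' + 1) = 0) : r = r' := by
  by_contra hne
  have hδ : (r - r' : ℤ_[2]) ≠ 0 := sub_ne_zero.2 (by exact_mod_cast hne)
  have hek := natCast_eq_of_legendreSum_eq_zero h
  -- A common range for both sums; the terms `i = 0` and `i = 1` are split off.
  rw [legendreSum_eq_sum_pairs e k r (N := r + r' + 2) (by omega), Finset.sum_range_succ',
    Finset.sum_range_succ'] at h
  rw [legendreSum_eq_sum_pairs e k r' (N := r + r' + 2) (by omega), Finset.sum_range_succ',
    Finset.sum_range_succ'] at h'
  obtain ⟨c, hc⟩ : (8 * (r - r') : ℤ_[2]) ∣ ∑ i ∈ Finset.range (r + r'), 2 ^ (i + 1 + 1 + 1) *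
      choosePair r (r + k) (i + 1 + 1) * pairCofactor e k r (i + 1 + 1) -
      ∑ i ∈ Finset.range (r + r'), 2 ^ (i + 1 + 1 + 1) *
      choosePair r' (r' + k) (i + 1 + 1) * pairCofactor e k r' (i + 1 + 1) := by
    rw [← Finset.sum_sub_distrib]
    refine Finset.dvd_sum fun i _ => ?_
    obtain ⟨d, hd⟩ := dvd_mul_sub_mul (sub_dvd_choosePair_sub r r' k (i + 1 + 1))
      ((Dvd.intro_left _ rfl).trans (two_mul_sub_dvd_pairCofactor_sub e k r r' (i + 1 + 1)))
    exact ⟨2 ^ i * d, by linear_combination 2 ^ (i + 1 + 1 + 1) * hd⟩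
  obtain ⟨d, hd⟩ := two_mul_sub_dvd_pairCofactor_sub e k r r' 1
  have h0 : pairCofactor e k r 0 - pairCofactor e k r' 0 =
      -2 * (r - r') * (r + r' + 1 + k) * (oddInv 0 * oddInv e) := by
    simp [pairCofactor, pairDefect, oddPart, oddProdInv]
    ring
  simp only [zero_add, choosePair_zero, choosePair_one] at h h'
  push_cast at h h'
  -- Difference of the two sums, divided by `4 * (r - r')`. Modulo 2, where `e = k`, it reads `r +
  -- r' + 1 + k = r + r' + k`.
  have key : (r + r' + 1 + k : ℤ_[2]) * (oddInv 0 * oddInv e) =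
      (r + r' + k) * pairCofactor e k r 1 + 2 * (r' * (r' + k) * d + c) := by
    refine mul_left_cancel₀ (mul_ne_zero (by norm_num : (4 : ℤ_[2]) ≠ 0) hδ) ?_
    linear_combination h' - h + hc + 2 * h0 + 4 * r' * (r' + k) * hd
  have h2 : (2 : ZMod 2) = 0 := rfl
  have := congrArg PadicInt.toZMod key
  simp only [toZMod_pairCofactor, toZMod_oddInv, map_mul, map_add, map_ofNat, map_natCast,
    map_one, h2, hek, zero_mul, Nat.cast_one, mul_one] at this
  refine one_ne_zero (α := ZMod 2) ?_
  linear_combination this + (r + r' + k : ZMod 2) * k * h2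

/-! ### From derivatives to trinomial coefficients and the 2-adic sum -/

lemma coeff_eq_zero_of_eval_iterate_derivative_eq_zero {l k : ℕ} {x : ℝ} (hx : 3 * x ^ 2 = 1)
    (h : (derivative^[k] ((X ^ 2 - 1 : ℝ[X]) ^ l)).eval x = 0) :
    ((X ^ 2 + 2 * X - 2 : ℤ[X]) ^ l).coeff k = 0 := by
  have h1 : (taylor x ((X ^ 2 - 1 : ℝ[X]) ^ l)).coeff k = 0 := by
    rw [taylor_coeff]
    rw [← factorial_smul_hasseDeriv] at h
    simpa [Nat.factorial_ne_zero] using h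
  -- Since `x ^ 2 = 1/3`, `(x * X + x) ^ 2 - 1 = (X ^ 2 + 2 * X - 2) / 3`.
  have h2 : (taylor x ((X ^ 2 - 1 : ℝ[X]) ^ l)).comp (C x * X) =
      C ((1 / 3) ^ l) * ((X ^ 2 + 2 * X - 2 : ℤ[X]) ^ l).map (Int.castRingHom ℝ) := by
    have hC : (C x : ℝ[X]) ^ 2 = C (1 / 3) := by
      rw [← C_pow]; congr 1; linarith
    have h3 : (C (1 / 3 : ℝ) : ℝ[X]) * 3 = 1 := by
      rw [← map_ofNat C 3, ← C_mul]; norm_num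
    simp only [taylor_apply, Polynomial.map_pow, pow_comp, sub_comp, X_comp, one_comp, add_comp,
      C_comp, Polynomial.map_sub, Polynomial.map_add, Polynomial.map_mul, map_X,
      Polynomial.map_ofNat, C_pow]
    rw [← mul_pow]
    congr 1
    linear_combination (X + 1) ^ 2 * hC + h3
  have h4 := congrArg (fun p => p.coeff k) h2
  simp only [comp_C_mul_X_coeff, h1, zero_mul, coeff_C_mul, coeff_map] at h4
  have h5 := (mul_eq_zero.1 h4.symm).resolve_left (by positivity)
  simpa using h5

lemma coeff_trinomial_pow (l m : ℕ) :
    ((X ^ 2 + 2 * X - 2 : ℤ[X]) ^ l).coeff (l + m) =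
      ∑ i ∈ Finset.range (l + 1),
        (l.choose i : ℤ) * (-2) ^ i * (2 ^ (l - m - 2 * i) * (l - i).choose (m + i)) := by
  have : (X ^ 2 + 2 * X - 2 : ℤ[X]) = C (-2) + X * (X + C 2) := by
    simp only [map_neg, map_ofNat]; ring
  rw [this, add_pow, finsetSum_coeff]
  refine Finset.sum_congr rfl fun i hi => ?_
  have hi : i ≤ l := by simpa [Nat.lt_succ_iff] using hi
  rw [← C_pow, mul_pow, ← C_eq_natCast, coeff_mul_C, coeff_C_mul,
    show l + m = (m + i) + (l - i) by omega, coeff_X_pow_mul, coeff_X_add_C_pow,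
    show l - i - (m + i) = l - m - 2 * i by omega]
  ring

/-- With `i = p - j`, the left binomials form the multinomial `l! / (i! * (m + i)! * (2 * j + e)!)`,
and `2 ^ j * j! / (2 * j + e)!` is `oddProdInv e j`. -/
lemma choose_mul_choose_eq {e m p j : ℕ} (he : e ≤ 1) (hj : j ≤ p) :
    (p.factorial * (p + m).factorial : ℤ_[2]) * ((m + (2 * p + e)).choose (p - j) *
        (m + (2 * p + e) - (p - j)).choose (m + (p - j))) * 2 ^ j =
      (m + (2 * p + e)).factorial * (choosePair p (p + m) j * oddProdInv e j) := by
  obtain ⟨i, rfl⟩ := Nat.exists_eq_add_of_le hj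
  have h1 := Nat.add_choose_mul_factorial_mul_factorial i (m + i + (2 * j + e))
  have h2 := Nat.add_choose_mul_factorial_mul_factorial (m + i) (2 * j + e)
  have h3 := Nat.add_choose_mul_factorial_mul_factorial j i
  have h4 := Nat.factorial_mul_descFactorial (show j ≤ j + i + m by omega)
  have h5 := factorial_mul_oddProdInv he j
  rw [← Nat.choose_symm_add] at h1 h2 h3
  rw [show j + i + m - j = m + i by omega] at h4
  rw [show m + (2 * (j + i) + e) = i + (m + i + (2 * j + e)) by ring, show j + i - j = i by omega,
    show i + (m + i + (2 * j + e)) - i = m + i + (2 * j + e) by omega, choosePair, ← h1, ← h2,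
    ← h3, ← h4]
  push_cast
  linear_combination (-((i + (m + i + (2 * j + e))).choose i : ℤ_[2]) *
    (m + i + (2 * j + e)).choose (m + i) * (j + i).choose j * i.factorial * (m + i).factorial *
    (j + i + m).descFactorial j) * h5

lemma legendreSum_eq_zero_of_coeff_eq_zero {e m p : ℕ} (he : e ≤ 1)
    (h : ((X ^ 2 + 2 * X - 2 : ℤ[X]) ^ (m + (2 * p + e))).coeff (m + (2 * p + e) + m) = 0) :
    legendreSum e m p = 0 := by
  -- Terms with `i > p` vanish; the rest are reindexed by `j = p - i`.
  rw [coeff_trinomial_pow, ← Finset.sum_subset (Finset.range_mono (show p + 1 ≤ _ by omega)),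
    ← Finset.sum_flip] at h
  · have h1 := congrArg (fun z : ℤ => (p.factorial * (p + m).factorial : ℤ_[2]) * z) h
    simp only [Int.cast_sum, Finset.mul_sum, Int.cast_zero, mul_zero] at h1
    have h2 : ((m + (2 * p + e)).factorial * (-1) ^ p * 2 ^ (p + e) : ℤ_[2]) *
        legendreSum e m p = 0 := by
      rw [← h1, legendreSum, Finset.mul_sum]
      refine Finset.sum_congr rfl fun j hj => ?_
      have hj : j ≤ p := by simpa [Nat.lt_succ_iff] using hj
      have h3 := choose_mul_choose_eq (m := m) he hj
      obtain ⟨i, rfl⟩ := Nat.exists_eq_add_of_le hj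
      rw [show m + (2 * (j + i) + e) - m - 2 * (j + i - j) = 2 * j + e by omega,
        show j + i - j = i by omega]
      rw [show j + i - j = i by omega] at h3
      push_cast
      have h4 : ((-2) ^ i : ℤ_[2]) = (-1) ^ i * 2 ^ i := by rw [← mul_pow]; norm_num
      have h5 : ((-1) ^ j * (-1) ^ j : ℤ_[2]) = 1 := by rw [← mul_pow]; norm_num
      rw [h4]
      simp only [pow_add, pow_mul']
      linear_combination (-((-1) ^ i * 2 ^ i * 2 ^ j * 2 ^ e)) * h3 +
        (-1) ^ i * 2 ^ i * 2 ^ j * 2 ^ e * (m + (2 * (j + i) + e)).factorial *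
          (choosePair (j + i) (j + i + m) j * oddProdInv e j) * h5
    refine (mul_eq_zero.1 h2).resolve_left (mul_ne_zero (mul_ne_zero ?_ ?_) ?_)
    · exact Nat.cast_ne_zero.2 (Nat.factorial_ne_zero _)
    · exact pow_ne_zero _ (by norm_num)
    · exact pow_ne_zero _ two_ne_zero
  · intro i _ hi
    have : p + 1 ≤ i := by simpa using hi
    rw [Nat.choose_eq_zero_of_lt (show m + (2 * p + e) - i < m + i by omega)]
    simp

lemma eq_of_coeff_trinomial_pow_eq_zero {m l₁ l₂ : ℕ} (h₁ : m ≤ l₁) (h₂ : m ≤ l₂)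
    (hc₁ : ((X ^ 2 + 2 * X - 2 : ℤ[X]) ^ l₁).coeff (l₁ + m) = 0)
    (hc₂ : ((X ^ 2 + 2 * X - 2 : ℤ[X]) ^ l₂).coeff (l₂ + m) = 0) : Even m ∧ l₁ = l₂ := by
  have key : ∀ l, m ≤ l → ((X ^ 2 + 2 * X - 2 : ℤ[X]) ^ l).coeff (l + m) = 0 →
      ∃ e k r : ℕ, e ≤ 1 ∧ m = 2 * k ∧ l = m + (2 * (2 * r + 1) + e) ∧
        legendreSum e (2 * k) (2 * r + 1) = 0 := by
    intro l hl hc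
    obtain ⟨n, rfl⟩ := Nat.exists_eq_add_of_le hl
    have hn : n = 2 * (n / 2) + n % 2 := by omega
    rw [hn] at hc
    have hs := legendreSum_eq_zero_of_coeff_eq_zero (by omega) hc
    have ho := odd_mul_of_legendreSum_eq_zero hs
    rw [Nat.odd_mul, Nat.odd_add] at ho
    obtain ⟨⟨r, hr⟩, hm⟩ := ho
    obtain ⟨k, hk⟩ := hm.1 ⟨r, hr⟩
    obtain rfl : m = 2 * k := by omega
    exact ⟨n % 2, k, r, by omega, rfl, by omega, hr ▸ hs⟩
  obtain ⟨e, k, r, he, rfl, rfl, hs⟩ := key l₁ h₁ hc₁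
  obtain ⟨e', k', r', he', hk', rfl, hs'⟩ := key l₂ h₂ hc₂
  obtain rfl : k = k' := by omega
  have hee : e ≡ e' [MOD 2] := (ZMod.natCast_eq_natCast_iff _ _ _).1
    ((natCast_eq_of_legendreSum_eq_zero hs).trans (natCast_eq_of_legendreSum_eq_zero hs').symm)
  obtain rfl : e = e' := by
    unfold Nat.ModEq at hee
    omega
  exact ⟨even_two_mul k, by rw [eq_of_legendreSum_eq_zero hs hs']⟩

/-! ### Divisibility of associated Legendre functions -/

lemma legendrePolynomial_two : legendrePolynomial 2 = C (1 / 2) * (3 * X ^ 2 - 1) := by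
  have : ((X ^ 2 - 1 : ℝ[X]) ^ 2) = X ^ 4 - 2 * X ^ 2 + 1 := by ring
  have h : (C (1 / 2) : ℝ[X]) = 4 * C (1 / 8) := by
    rw [← map_ofNat C 4, ← C_mul]; norm_num
  rw [legendrePolynomial, this, h]
  norm_num [Function.iterate_succ, derivative_pow, Nat.factorial]
  simp only [map_ofNat]
  ring

/-- The prefactor is `± (1 - X ^ 2) ^ (m / 2)` with floor division, for both parities of `m`. It is
nonzero at the roots of `P_2`, so it cannot contribute to divisibility. -/
lemma exists_associatedLegendre_div_eq_eval (m : ℕ) : ∃ q : ℝ[X], (∀ x : ℝ, 3 * x ^ 2 = 1 →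
    q.eval x ≠ 0) ∧ ∀ l, ∀ x ∈ Set.Ioo (-1 : ℝ) 1,
      associatedLegendre l m x / (if Even m then 1 else Real.sqrt (1 - x ^ 2)) =
        (q * derivative^[m] (legendrePolynomial l)).eval x := by
  refine ⟨(-1) ^ m * (1 - X ^ 2) ^ (m / 2), fun x hx => ?_, fun l x hx => ?_⟩
  · simp only [eval_mul, eval_pow, eval_neg, eval_one, eval_sub, eval_X]
    exact mul_ne_zero (pow_ne_zero _ (by norm_num)) (pow_ne_zero _ (by nlinarith))
  · have hpos : 0 < 1 - x ^ 2 := by nlinarith [hx.1, hx.2]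
    have hs := Real.sq_sqrt hpos.le
    have hs0 := (Real.sqrt_pos.2 hpos).ne'
    simp only [associatedLegendre, eval_mul, eval_pow, eval_neg, eval_one, eval_sub, eval_X]
    rw [← hs, ← pow_mul, Real.sqrt_sq (Real.sqrt_nonneg _)]
    split_ifs with hm
    · rw [Nat.two_mul_div_two_of_even hm, div_one]
    · have : Real.sqrt (1 - x ^ 2) ^ m = Real.sqrt (1 - x ^ 2) ^ (2 * (m / 2)) *
          Real.sqrt (1 - x ^ 2) := by
        rw [← pow_succ, Nat.two_mul_div_two_add_one_of_odd (Nat.not_even_iff_odd.1 hm)]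
      rw [this]
      field_simp

lemma coeff_trinomial_pow_eq_zero_of_dvd {l m : ℕ}
    (h : DvdAssociatedLegendre (legendrePolynomial 2) l m) :
    ((X ^ 2 + 2 * X - 2 : ℤ[X]) ^ l).coeff (l + m) = 0 := by
  obtain ⟨R, hR, Q, rfl⟩ := h
  obtain ⟨q, hq, hqR⟩ := exists_associatedLegendre_div_eq_eval m
  -- Agreement on an interval is an identity of polynomials, which may be evaluated at a root of
  -- `P_2`.
  have heq : q * derivative^[m] (legendrePolynomial l) = legendrePolynomial 2 * Q :=
    eq_of_infinite_eval_eq _ _ ((Set.Ioo_infinite (by norm_num : (-1 : ℝ) < 1)).mono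
      fun x hx => (hqR l x hx).symm.trans (hR x hx))
  obtain ⟨x, hx⟩ : ∃ x : ℝ, 3 * x ^ 2 = 1 := ⟨Real.sqrt (1 / 3), by
    rw [Real.sq_sqrt (by norm_num)]; norm_num⟩
  refine coeff_eq_zero_of_eval_iterate_derivative_eq_zero hx ?_
  have h := congrArg (eval x) heq
  rw [eval_mul, legendrePolynomial_two] at h
  simp only [eval_mul, eval_sub, eval_pow, eval_X, eval_one, eval_ofNat, hx, sub_self, mul_zero,
    zero_mul] at h
  have h := (mul_eq_zero.1 h).resolve_left (hq x hx)
  rw [legendrePolynomial, iterate_derivative_C_mul, ← Function.iterate_add_apply, eval_mul,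
    eval_C] at h
  rw [add_comm l m]
  exact (mul_eq_zero.1 h).resolve_left (by positivity)

lemma dvdAssociatedLegendre_of_dvd {l m : ℕ} {p : ℝ[X]}
    (h : p ∣ derivative^[m] (legendrePolynomial l)) : DvdAssociatedLegendre p l m := by
  obtain ⟨q, -, hqR⟩ := exists_associatedLegendre_div_eq_eval m
  exact ⟨_, hqR l, h.mul_left q⟩

lemma iterate_derivative_X_sq_sub_one_pow_five :
    derivative^[7] ((X ^ 2 - 1 : ℝ[X]) ^ 5) = C 201600 * (X * (3 * X ^ 2 - 1)) := by
  have h : ((X ^ 2 - 1 : ℝ[X]) ^ 5) =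
      X ^ 10 - C 5 * X ^ 8 + (C 10 * X ^ 6 - C 10 * X ^ 4 + C 5 * X ^ 2 - C 1) := by
    simp only [map_ofNat, map_one]; ring
  have h0 : derivative^[7] (C 10 * X ^ 6 - C 10 * X ^ 4 + C 5 * X ^ 2 - C 1 : ℝ[X]) = 0 :=
    iterate_derivative_eq_zero (lt_of_le_of_lt (b := 6) (by compute_degree) (by norm_num))
  have h10 : Nat.descFactorial 10 7 = 604800 := by norm_num [Nat.descFactorial]
  have h8 : Nat.descFactorial 8 7 = 40320 := by norm_num [Nat.descFactorial]
  rw [h, iterate_map_add, iterate_derivative_sub, h0, iterate_derivative_C_mul,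
    iterate_derivative_X_pow_eq_natCast_mul, iterate_derivative_X_pow_eq_natCast_mul, h10, h8]
  simp only [map_ofNat, Nat.cast_ofNat, Nat.reduceSub]
  ring

lemma dvdAssociatedLegendre_five_two : DvdAssociatedLegendre (legendrePolynomial 2) 5 2 := by
  refine dvdAssociatedLegendre_of_dvd ⟨C 105 * X, ?_⟩
  have hf : (1 / (2 ^ 5 * (Nat.factorial 5 : ℝ))) * 201600 = 1 / 2 * 105 := by
    norm_num [Nat.factorial]
  rw [legendrePolynomial_two, legendrePolynomial, iterate_derivative_C_mul,
    ← Function.iterate_add_apply, iterate_derivative_X_sq_sub_one_pow_five, ← mul_assoc, ← C_mul,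
    hf, C_mul]
  ring

theorem mainTheorem1 :
    (∀ l : ℕ, legendrePolynomial 2 ∣ legendrePolynomial l ↔ l = 2) ∧
    (∀ l : ℕ, 2 ≤ l → (DvdAssociatedLegendre (legendrePolynomial 2) l 2 ↔ l = 5)) ∧
    (∀ m : ℕ, Even m → ∀ l₁ l₂ : ℕ, m ≤ l₁ → m ≤ l₂ →
      DvdAssociatedLegendre (legendrePolynomial 2) l₁ m →
      DvdAssociatedLegendre (legendrePolynomial 2) l₂ m → l₁ = l₂) ∧
    (∀ m : ℕ, Odd m → ∀ l : ℕ, m ≤ l →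
      ¬ DvdAssociatedLegendre (legendrePolynomial 2) l m) := by
  have key : ∀ m l₁ l₂ : ℕ, m ≤ l₁ → m ≤ l₂ →
      DvdAssociatedLegendre (legendrePolynomial 2) l₁ m →
      DvdAssociatedLegendre (legendrePolynomial 2) l₂ m → Even m ∧ l₁ = l₂ :=
    fun m l₁ l₂ h₁ h₂ hd₁ hd₂ => eq_of_coeff_trinomial_pow_eq_zero h₁ h₂
      (coeff_trinomial_pow_eq_zero_of_dvd hd₁) (coeff_trinomial_pow_eq_zero_of_dvd hd₂)
  refine ⟨fun l => ⟨fun h => ?_, ?_⟩, fun l hl => ⟨fun h => ?_, ?_⟩,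
    fun m _ l₁ l₂ h₁ h₂ hd₁ hd₂ => (key m l₁ l₂ h₁ h₂ hd₁ hd₂).2,
    fun m hm l hl h => Nat.not_even_iff_odd.2 hm (key m l l hl hl h h).1⟩
  · exact (key 0 l 2 l.zero_le (Nat.zero_le 2) (dvdAssociatedLegendre_of_dvd h)
      (dvdAssociatedLegendre_of_dvd dvd_rfl)).2
  · rintro rfl
    exact dvd_rfl
  · exact (key 2 l 5 hl (by norm_num) h dvdAssociatedLegendre_five_two).2
  · rintro rfl
    exact dvdAssociatedLegendre_five_two
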